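/- Let $\mathbb{BC}=\{z_1+jz_2 : z_1,z_2\in\mathbb{C}\}$, with $j^2=-1$ and $ij=ji$, be the algebra of bicomplex numbers with the Euclidean norm $|z_1+jz_2|^2=|z_1|^2+|z_2|^2$, let $e_\pm=\frac{1\pm ij}{2}$, and write $Z=z_1+jz_2=\alpha e_++\beta e_-$ with $\alpha=z_1-iz_2$, $\beta=z_1+iz_2\in\mathbb{C}$. Put $Z^*=\overline{z_1}-j\,\overline{z_2}=\overline{\alpha}e_++\overline{\beta}e_-$, $e^Z=e^{\alpha}e_++e^{\beta}e_-$ and $\sqrt{Z}=\sqrt{\alpha}\,e_++\sqrt{\beta}\,e_-$ (principal square roots). For $\sigma>0$ let $c_0^\sigma=(\sigma/\pi)^{1/2}$ and let $L^{2,\sigma}_{\mathbb{BC}}(\mathbb{R})$ be the space of (classes of) functions $\psi:\mathbb{R}\to\mathbb{BC}$ that are square integrable with respect to $c_0^\sigma e^{-\sigma x^2}dx$. For $\theta=ae_++be_-$ with $|a|=|b|=1$ and $1-\theta^2$ invertible in $\mathbb{BC}$ (that is, $a\neq\pm1$ and $b\neq\pm1$), the bicomplex fractional Fourier transform of $\psi\in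 L^{2,\sigma}_{\mathbb{BC}}(\mathbb{R})$ is $$\mathcal{F}^\sigma_\theta\psi(y)=\frac{c_0^\sigma}{\sqrt{1-\theta^2}}\int_{\mathbb{R}}\psi(x)\,e^{-\frac{\sigma}{1-\theta^2}(x-\theta y)^2}\,dx,$$ where the integral is the limit in $L^{2,\sigma}_{\mathbb{BC}}(\mathbb{R})$, as $R\to\infty$, of the integrals over $[-R,R]$. Then $\mathcal{F}^\sigma_\theta$ and $\mathcal{F}^\sigma_{\theta^*}$ are well defined on all of $L^{2,\sigma}_{\mathbb{BC}}(\mathbb{R})$, and $\mathcal{F}^\sigma_\theta$ is a bijection of this space onto itself whose inverse is $\mathcal{F}^\sigma_{\theta^*}$; that is, for every $\psi\in L^{2,\sigma}_{\mathbb{BC}}(\mathbb{R})$, $$[\mathcal{F}^\sigma_\theta]^{-1}\psi(x)=\frac{c_0^\sigma}{\sqrt{1-(\theta^*)^2}}\int_{\mathbb{R}}\psi(y)\,e^{-\frac{\sigma}{1-(\theta^*)^2}(y-\theta^*x)^2}\,dy,$$ with the integral understood in the same sense. Moreover, in both formulas, for almost every value of the free variable at which the integral converges absolutely, the formula holds with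 the ordinary Lebesgue integral. -/

import Mathlib

open MeasureTheory Filter Topology

noncomputable section

/-- The bicomplex numbers `Z = z₁ + j z₂` with `z₁, z₂ ∈ ℂ`, `j² = -1` and `i j = j i`;
`z₁` is `Z.re` and `z₂` is `Z.im`. -/
abbrev Bicomplex : Type := QuadraticAlgebra ℂ (-1) 0

namespace Bicomplex

/-- `Z = z₁ + j z₂` as the point `(z₁, z₂)` of the Euclidean space `ℂ²`. -/
def toEuclid : Bicomplex →ₗ[ℝ] WithLp 2 (ℂ × ℂ) where
  toFun Z := WithLp.toLp 2 (Z.re, Z.im)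
  map_add' _ _ := rfl
  map_smul' _ _ := rfl

theorem toEuclid_injective : Function.Injective toEuclid := by
  intro Z W h
  have h' : ((Z.re, Z.im) : ℂ × ℂ) = (W.re, W.im) := congrArg WithLp.ofLp h
  exact QuadraticAlgebra.ext (congrArg Prod.fst h') (congrArg Prod.snd h')

/-- The Euclidean norm `|Z|² = |z₁|² + |z₂|²`. -/
instance : NormedAddCommGroup Bicomplex :=
  NormedAddCommGroup.induced Bicomplex (WithLp 2 (ℂ × ℂ)) toEuclid toEuclid_injective

instance : NormedSpace ℝ Bicomplex :=
  NormedSpace.induced ℝ Bicomplex (WithLp 2 (ℂ × ℂ)) toEuclid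

/-- The idempotent `e₊ = (1 + i j) / 2`. -/
def ePlus : Bicomplex := ⟨1 / 2, Complex.I / 2⟩

/-- The idempotent `e₋ = (1 - i j) / 2`. -/
def eMinus : Bicomplex := ⟨1 / 2, -Complex.I / 2⟩

/-- The component `α = z₁ - i z₂` in `Z = α e₊ + β e₋`. -/
def plus (Z : Bicomplex) : ℂ := Z.re - Complex.I * Z.im

/-- The component `β = z₁ + i z₂` in `Z = α e₊ + β e₋`. -/
def minus (Z : Bicomplex) : ℂ := Z.re + Complex.I * Z.im

/-- The bicomplex number `α e₊ + β e₋`. -/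
def ofIdem (α β : ℂ) : Bicomplex := α • ePlus + β • eMinus

/-- The conjugate `Z^* = conj z₁ - j conj z₂`. -/
def conjStar (Z : Bicomplex) : Bicomplex :=
  ⟨(starRingEnd ℂ) Z.re, -(starRingEnd ℂ) Z.im⟩

/-- The exponential `e^Z = e^α e₊ + e^β e₋`. -/
def exp (Z : Bicomplex) : Bicomplex := ofIdem (Complex.exp Z.plus) (Complex.exp Z.minus)

/-- The principal square root, taken on both idempotent components. -/
def sqrt (Z : Bicomplex) : Bicomplex :=
  ofIdem (Z.plus ^ (1 / 2 : ℂ)) (Z.minus ^ (1 / 2 : ℂ))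

/-- A real number as a bicomplex number. -/
def ofReal (x : ℝ) : Bicomplex := algebraMap ℝ Bicomplex x

/-- The set `S¹ e₊ + S¹ e₋`. -/
def unitTorus : Set Bicomplex := {θ | ∃ a b : ℂ, ‖a‖ = 1 ∧ ‖b‖ = 1 ∧ θ = ofIdem a b}

/-- The normalization `c₀^σ = (σ / π)^{1/2}`. -/
def c0 (σ : ℝ) : ℝ := Real.sqrt (σ / Real.pi)

/-- The Gaussian measure `c₀^σ e^{-σ x²} dx` on the real line. -/
def gaussMeasure (σ : ℝ) : Measure ℝ :=
  volume.withDensity fun x => ENNReal.ofReal (c0 σ * Real.exp (-σ * x ^ 2))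

/-- The space `L^{2,σ}_{𝔹ℂ}(ℝ)` of (classes of) bicomplex-valued functions that are
square integrable for the Gaussian measure. -/
abbrev L2 (σ : ℝ) := Lp Bicomplex 2 (gaussMeasure σ)

/-- The factor `c₀^σ / √(1 - θ²)`; the inverse is genuine when `1 - θ²` is invertible. -/
def prefactor (σ : ℝ) (θ : Bicomplex) : Bicomplex :=
  ofReal (c0 σ) * Ring.inverse (sqrt (1 - θ ^ 2))

/-- The Gaussian `exp(-σ / (1 - θ²) (x - θ y)²)`, with `x` the variable of integration. -/
def kernel (σ : ℝ) (θ : Bicomplex) (x y : ℝ) : Bicomplex :=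
  exp (-(ofReal σ * Ring.inverse (1 - θ ^ 2)) * (ofReal x - θ * ofReal y) ^ 2)

/-- `g` is the fractional Fourier transform of `ψ` with parameter `θ`: the integral
`c₀^σ / √(1 - θ²) ∫ ψ(x) exp(-σ / (1 - θ²) (x - θ y)²) dx`, taken over `[-R, R]`, tends to `g(y)`
in `L^{2,σ}_{𝔹ℂ}(ℝ)` as `R → ∞`. For `|α| = |β| = 1` the modulus of the idempotent components of
the kernel is `e^{-σ x² / 2}` up to a factor that depends on `y` only, so for general `ψ` the
integral is not absolutely convergent; it is an `L²` limit, as for the Fourier transform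
on `L²(ℝ)`. -/
def HasBFrFT (σ : ℝ) (θ : Bicomplex) (ψ g : L2 σ) : Prop :=
  Tendsto
    (fun R : ℝ => eLpNorm
      (fun y => prefactor σ θ * (∫ x in Set.Icc (-R) R, ψ x * kernel σ θ x y) - g y)
      2 (gaussMeasure σ))
    atTop (𝓝 0)

open Classical in
/-- The fractional Fourier transform `𝓕_θ^σ` on `L^{2,σ}_{𝔹ℂ}(ℝ)` (zero where the defining
limit does not exist). -/
def bfrft (σ : ℝ) (θ : Bicomplex) (ψ : L2 σ) : L2 σ :=
  if h : ∃ g : L2 σ, HasBFrFT σ θ ψ g then h.choose else 0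

end Bicomplex

end

/-! The idempotents decouple everything: the components of the transform are scalar transforms with
parameters a, b on the unit circle, and Z ↦ Z^* conjugates each component. For |a| = 1, a² ≠ 1 one
has 1/(1 - a²) = 1/2 + iκ and a/(1 - a²) = im with κ, m real. Multiplication by `weight`, the root
of the Gaussian density, is an isometry onto L²(dx), and it turns the scalar kernel into chirp(x)
chirp(y) exp(2iσm xy) (`weight_mul_chirpKernel`). Hence the transform is a chirp, then the Fourier
transform, then a dilation by l = -σm/π, then a chirp, times a constant p.

Conjugating a negates κ and m, which inverts the chirps and replaces 𝓕 by 𝓕⁻. The two constants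
multiply to |p|² = σ|m|/π = |l|, the Jacobian of the dilation, so the transforms are mutually
inverse (`exists_chirp_transform`).

Truncated integrals converge because 𝓕 is an L² isometry given by its integral on L¹ ∩ L².
Convergence in measure then yields uniqueness of the limit and, along a subsequence, the pointwise
formula. -/

section Fourier

open scoped FourierTransform SchwartzMap ContDiff

/-! ### The L² Fourier transform as a limit of truncated integrals -/

/-- Fourier transforms of integrable functions are locally integrable. -/
theorem locallyIntegrable_fourier {f : ℝ → ℂ} (hf : Integrable f) :
    LocallyIntegrable (𝓕 f) :=
  (VectorFourier.fourierIntegral_continuous Real.continuous_fourierChar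
    (by fun_prop) hf).locallyIntegrable

theorem integral_fourier_mul_comm {f g : ℝ → ℂ} (hf : Integrable f) (hg : Integrable g) :
    ∫ x, 𝓕 f x * g x = ∫ x, f x * 𝓕 g x := by
  have := VectorFourier.integral_fourierIntegral_smul_eq_flip (μ := volume) (ν := volume)
    (L := innerₗ ℝ) (f := f) (g := g) Real.continuous_fourierChar (by fun_prop) hf hg
  rw [flip_innerₗ] at this
  exact this

theorem integral_fourierInv_mul_comm {f g : ℝ → ℂ} (hf : Integrable f) (hg : Integrable g) :
    ∫ x, 𝓕⁻ f x * g x = ∫ x, f x * 𝓕⁻ g x := by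
  calc ∫ x, 𝓕⁻ f x * g x = ∫ x, 𝓕 (fun x => f (-x)) x * g x := by
        simp_rw [Real.fourierInv_eq_fourier_comp_neg]
    _ = ∫ x, f (-x) * 𝓕 g x := integral_fourier_mul_comm hf.comp_neg hg
    _ = ∫ x, f (- -x) * 𝓕 g (-x) := (integral_neg_eq_self (fun x => f (-x) * 𝓕 g x) volume).symm
    _ = ∫ x, f x * 𝓕⁻ g x := by simp_rw [neg_neg, Real.fourierInv_eq_fourier_neg]

/-- On `L¹ ∩ L²` the `L²` Fourier transform is the Fourier integral. -/
theorem fourier_toLp_ae_eq {f : ℝ → ℂ} (hf : Integrable f) (hf2 : MemLp f 2) :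
    (𝓕 (hf2.toLp f) : Lp ℂ 2 (volume : Measure ℝ)) =ᵐ[volume] 𝓕 f := by
  refine ae_eq_of_integral_contDiff_smul_eq
    ((Lp.memLp _).locallyIntegrable (by norm_num)) (locallyIntegrable_fourier hf) ?_
  intro g g_smooth g_cpt
  have hg₁ : HasCompactSupport (Complex.ofRealCLM ∘ g) := g_cpt.comp_left rfl
  have hg₂ : ContDiff ℝ ∞ (Complex.ofRealCLM ∘ g) := by fun_prop
  set G : 𝓢(ℝ, ℂ) := hg₁.toSchwartzMap hg₂
  -- As a tempered distribution, the L² transform acts on `G` by pairing the class of `f` with `𝓕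
  -- G`; the self-adjointness of the Fourier integral moves `𝓕` back onto `f`.
  have h := congrArg (fun T => T G) (Lp.fourier_toTemperedDistribution_eq (hf2.toLp f))
  simp only [TemperedDistribution.fourier_apply, Lp.toTemperedDistribution_apply] at h
  calc ∫ x, g x • (𝓕 (hf2.toLp f) : Lp ℂ 2 (volume : Measure ℝ)) x
      = ∫ x, G x • (𝓕 (hf2.toLp f) : Lp ℂ 2 (volume : Measure ℝ)) x := by simp [G]
    _ = ∫ x, (𝓕 G) x • (hf2.toLp f) x := h.symm
    _ = ∫ x, 𝓕 (G : ℝ → ℂ) x * f x := by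
        refine integral_congr_ae ?_
        filter_upwards [hf2.coeFn_toLp] with x hx
        rw [hx, SchwartzMap.fourier_coe, smul_eq_mul]
    _ = ∫ x, G x * 𝓕 f x := integral_fourier_mul_comm G.integrable hf
    _ = ∫ x, g x • 𝓕 f x := by simp [G]

theorem fourierInv_toLp_ae_eq {f : ℝ → ℂ} (hf : Integrable f) (hf2 : MemLp f 2) :
    (𝓕⁻ (hf2.toLp f) : Lp ℂ 2 (volume : Measure ℝ)) =ᵐ[volume] 𝓕⁻ f := by
  refine ae_eq_of_integral_contDiff_smul_eq
    ((Lp.memLp _).locallyIntegrable (by norm_num)) ?_ ?_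
  · rw [Real.fourierInv_eq_fourier_comp_neg]
    exact locallyIntegrable_fourier hf.comp_neg
  intro g g_smooth g_cpt
  have hg₁ : HasCompactSupport (Complex.ofRealCLM ∘ g) := g_cpt.comp_left rfl
  have hg₂ : ContDiff ℝ ∞ (Complex.ofRealCLM ∘ g) := by fun_prop
  set G : 𝓢(ℝ, ℂ) := hg₁.toSchwartzMap hg₂
  have h := congrArg (fun T => T G) (Lp.fourierInv_toTemperedDistribution_eq (hf2.toLp f))
  simp only [TemperedDistribution.fourierInv_apply, Lp.toTemperedDistribution_apply] at h
  calc ∫ x, g x • (𝓕⁻ (hf2.toLp f) : Lp ℂ 2 (volume : Measure ℝ)) x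
      = ∫ x, G x • (𝓕⁻ (hf2.toLp f) : Lp ℂ 2 (volume : Measure ℝ)) x := by simp [G]
    _ = ∫ x, (𝓕⁻ G) x • (hf2.toLp f) x := h.symm
    _ = ∫ x, 𝓕⁻ (G : ℝ → ℂ) x * f x := by
        refine integral_congr_ae ?_
        filter_upwards [hf2.coeFn_toLp] with x hx
        rw [hx, SchwartzMap.fourierInv_coe, smul_eq_mul]
    _ = ∫ x, G x * 𝓕⁻ f x := integral_fourierInv_mul_comm G.integrable hf
    _ = ∫ x, g x • 𝓕⁻ f x := by simp [G]

/-- The truncations of a square integrable function to `[-R, R]` converge to it in `L²`. -/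
theorem tendsto_eLpNorm_indicator_Icc_sub {f : ℝ → ℂ} (hf : MemLp f 2) :
    Tendsto (fun R : ℝ => eLpNorm ((Set.Icc (-R) R).indicator f - f) 2 volume) atTop (𝓝 0) := by
  have h2 : ∫⁻ x, ‖f x‖ₑ ^ (2 : ℝ) ≠ ⊤ := by
    have := (lintegral_rpow_enorm_lt_top_of_eLpNorm_lt_top (by norm_num) (by norm_num) hf.2).ne
    simpa using this
  have key : Tendsto (fun R : ℝ =>
      ∫⁻ x, ‖((Set.Icc (-R) R).indicator f - f) x‖ₑ ^ (2 : ℝ)) atTop (𝓝 (∫⁻ _ : ℝ, 0)) := by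
    refine tendsto_lintegral_filter_of_dominated_convergence' (fun x => ‖f x‖ₑ ^ (2 : ℝ)) ?_ ?_
      h2 ?_
    · refine Eventually.of_forall fun R => ?_
      exact (((hf.1.indicator measurableSet_Icc).sub hf.1).enorm).pow_const _
    · refine Eventually.of_forall fun R => Eventually.of_forall fun x => ?_
      by_cases hx : x ∈ Set.Icc (-R) R <;> simp [hx]
    · refine Eventually.of_forall fun x => ?_
      refine tendsto_const_nhds.congr' ?_
      filter_upwards [eventually_ge_atTop |x|] with R hR
      have hx : x ∈ Set.Icc (-R) R := abs_le.1 hR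
      simp [hx]
  have h := key.ennrpow_const (1 / 2)
  simp only [eLpNorm_eq_lintegral_rpow_enorm_toReal (p := 2) (by norm_num) (by norm_num)]
  simpa using h

theorem integrable_indicator_Icc_of_memLp {f : ℝ → ℂ} (hf : MemLp f 2) (R : ℝ) :
    Integrable ((Set.Icc (-R) R).indicator f) := by
  rw [integrable_indicator_iff measurableSet_Icc]
  exact (hf.restrict _).integrable (by norm_num)

/-- An isometry carries the error of truncating `f` to the error of the transforms. Stated for an
abstract `T` so that it serves both 𝓕 and 𝓕⁻. -/
theorem tendsto_eLpNorm_truncation (T : Lp ℂ 2 (volume : Measure ℝ) ≃ₗᵢ[ℂ] Lp ℂ 2 (volume : Measure ℝ))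
    (S : (ℝ → ℂ) → ℝ → ℂ)
    (hTS : ∀ {f : ℝ → ℂ} (_ : Integrable f) (hf2 : MemLp f 2), T (hf2.toLp f) =ᵐ[volume] S f)
    (f : Lp ℂ 2 (volume : Measure ℝ)) :
    Tendsto (fun R : ℝ => eLpNorm (fun w => S ((Set.Icc (-R) R).indicator f) w - T f w) 2 volume)
      atTop (𝓝 0) := by
  refine (tendsto_eLpNorm_indicator_Icc_sub (Lp.memLp f)).congr fun R => ?_
  have hm : MemLp ((Set.Icc (-R) R).indicator f) 2 := (Lp.memLp f).indicator measurableSet_Icc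
  have h1 := hTS (integrable_indicator_Icc_of_memLp (Lp.memLp f) R) hm
  calc eLpNorm ((Set.Icc (-R) R).indicator f - ⇑f) 2 volume
      = ‖hm.toLp _ - f‖ₑ := by
        rw [Lp.enorm_def]
        refine eLpNorm_congr_ae ?_
        filter_upwards [Lp.coeFn_sub (hm.toLp _) f, hm.coeFn_toLp] with x hx hy
        rw [hx, Pi.sub_apply, Pi.sub_apply, hy]
    _ = ‖T (hm.toLp _) - T f‖ₑ := by
        rw [← map_sub, T.enorm_map]
    _ = _ := by
        rw [Lp.enorm_def]
        refine eLpNorm_congr_ae ?_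
        filter_upwards [Lp.coeFn_sub (T (hm.toLp _)) (T f), h1] with x hx hy
        rw [hx, Pi.sub_apply, hy]

/-- The Fourier transform on `L²` is the limit of the integrals over `[-R, R]`. -/
theorem tendsto_eLpNorm_fourier_truncation (f : Lp ℂ 2 (volume : Measure ℝ)) :
    Tendsto (fun R : ℝ => eLpNorm (fun w => (∫ x in Set.Icc (-R) R,
        f x * Complex.exp (↑(-2 * Real.pi * x * w) * Complex.I))
        - (𝓕 f : Lp ℂ 2 (volume : Measure ℝ)) w) 2 volume) atTop (𝓝 0) := by
  refine (tendsto_eLpNorm_truncation (Lp.fourierTransformₗᵢ ℝ ℂ) (fun f => 𝓕 f)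
    (fun hf hf2 => fourier_toLp_ae_eq hf hf2) f).congr fun R => ?_
  congr 1
  ext w
  congr 1
  rw [Real.fourier_eq', ← integral_indicator measurableSet_Icc]
  congr 1
  ext x
  by_cases hx : x ∈ Set.Icc (-R) R
  · simp only [Set.indicator_of_mem hx, smul_eq_mul]
    rw [mul_comm]; congr 3; simp; ring
  · simp [Set.indicator_of_notMem hx]

theorem tendsto_eLpNorm_fourierInv_truncation (f : Lp ℂ 2 (volume : Measure ℝ)) :
    Tendsto (fun R : ℝ => eLpNorm (fun w => (∫ x in Set.Icc (-R) R,
        f x * Complex.exp (↑(2 * Real.pi * x * w) * Complex.I))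
        - (𝓕⁻ f : Lp ℂ 2 (volume : Measure ℝ)) w) 2 volume) atTop (𝓝 0) := by
  refine (tendsto_eLpNorm_truncation (Lp.fourierTransformₗᵢ ℝ ℂ).symm (fun f => 𝓕⁻ f)
    (fun hf hf2 => fourierInv_toLp_ae_eq hf hf2) f).congr fun R => ?_
  congr 1
  ext w
  congr 1
  rw [Real.fourierInv_eq', ← integral_indicator measurableSet_Icc]
  congr 1
  ext x
  by_cases hx : x ∈ Set.Icc (-R) R
  · simp only [Set.indicator_of_mem hx, smul_eq_mul]
    rw [mul_comm]; congr 3; simp; ring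
  · simp [Set.indicator_of_notMem hx]

/-! ### Dilations -/

theorem eLpNorm_comp_mul_left (h : ℝ → ℂ) {l : ℝ} (hl : l ≠ 0) :
    eLpNorm (fun y => h (l * y)) 2 volume
      = ENNReal.ofReal |l⁻¹| ^ (1 / 2 : ℝ) * eLpNorm h 2 volume := by
  have he : MeasurableEmbedding (fun y : ℝ => l * y) :=
    (Homeomorph.mulLeft₀ l hl).measurableEmbedding
  have h1 := he.eLpNorm_map_measure (μ := volume) (g := h) (p := 2)
  rw [Real.map_volume_mul_left hl, eLpNorm_smul_measure_of_ne_zero (by simpa using hl)] at h1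
  simpa [Function.comp_def] using h1.symm

theorem memLp_comp_mul_left {h : ℝ → ℂ} (hh : MemLp h 2) {l : ℝ} (hl : l ≠ 0) :
    MemLp (fun y => h (l * y)) 2 := by
  have he : MeasurableEmbedding (fun y : ℝ => l * y) :=
    (Homeomorph.mulLeft₀ l hl).measurableEmbedding
  have := (he.memLp_map_measure_iff (μ := volume) (g := h) (p := 2)).1
    (by rw [Real.map_volume_mul_left hl]; exact hh.smul_measure (by simp))
  simpa [Function.comp_def] using this

/-- The interval is symmetric, so a negative `l` only enters through `|l|`. -/
theorem setIntegral_Icc_comp_mul_left (h : ℝ → ℂ) {l : ℝ} (hl : l ≠ 0) (R : ℝ) :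
    ∫ x in Set.Icc (-R) R, h (l * x)
      = (|l|⁻¹ : ℝ) * ∫ u in Set.Icc (-(|l| * R)) (|l| * R), h u := by
  rw [← integral_indicator measurableSet_Icc, ← integral_indicator measurableSet_Icc]
  have := Measure.integral_comp_mul_left ((Set.Icc (-(|l| * R)) (|l| * R)).indicator h) l
  rw [abs_inv, Complex.real_smul] at this
  rw [← this]
  congr 1
  ext x
  have hx : l * x ∈ Set.Icc (-(|l| * R)) (|l| * R) ↔ x ∈ Set.Icc (-R) R := by
    rw [Set.mem_Icc, ← abs_le, Set.mem_Icc, ← abs_le, abs_mul,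
      mul_le_mul_iff_right₀ (abs_pos.2 hl)]
  by_cases h' : x ∈ Set.Icc (-R) R
  · rw [Set.indicator_of_mem h', Set.indicator_of_mem (hx.2 h')]
  · rw [Set.indicator_of_notMem h', Set.indicator_of_notMem (fun h => h' (hx.1 h))]

end Fourier

namespace Bicomplex

noncomputable section

open scoped FourierTransform

/-! ### The Gaussian weight as an isometry onto L²(dx) -/

/-- The square root of the density of the Gaussian measure. -/
def weight (σ x : ℝ) : ℝ := Real.sqrt (c0 σ) * Real.exp (-σ * x ^ 2 / 2)

theorem c0_pos {σ : ℝ} (hσ : 0 < σ) : 0 < c0 σ := Real.sqrt_pos.2 (by positivity)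

theorem c0_nonneg (σ : ℝ) : 0 ≤ c0 σ := Real.sqrt_nonneg _

theorem weight_nonneg (σ x : ℝ) : 0 ≤ weight σ x :=
  mul_nonneg (Real.sqrt_nonneg _) (Real.exp_pos _).le

theorem weight_pos {σ : ℝ} (hσ : 0 < σ) (x : ℝ) : 0 < weight σ x :=
  mul_pos (Real.sqrt_pos.2 (c0_pos hσ)) (Real.exp_pos _)

theorem continuous_weight (σ : ℝ) : Continuous (weight σ) := by
  unfold weight; fun_prop

theorem weight_sq (σ x : ℝ) : weight σ x ^ 2 = c0 σ * Real.exp (-σ * x ^ 2) := by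
  rw [weight, mul_pow, Real.sq_sqrt (c0_nonneg σ), ← Real.exp_nat_mul]
  congr 2
  push_cast
  ring

theorem volume_absolutelyContinuous_gaussMeasure {σ : ℝ} (hσ : 0 < σ) :
    (volume : Measure ℝ) ≪ gaussMeasure σ := by
  refine withDensity_absolutelyContinuous' (by fun_prop) (ae_of_all _ fun x => ?_)
  simpa using mul_pos (c0_pos hσ) (Real.exp_pos _)

theorem gaussMeasure_absolutelyContinuous_volume (σ : ℝ) :
    gaussMeasure σ ≪ (volume : Measure ℝ) :=
  withDensity_absolutelyContinuous _ _

theorem eLpNorm_gaussMeasure {σ : ℝ} (h : ℝ → ℂ) :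
    eLpNorm h 2 (gaussMeasure σ) = eLpNorm (fun x => (weight σ x : ℂ) * h x) 2 volume := by
  simp only [eLpNorm_eq_lintegral_rpow_enorm_toReal (p := 2) (by norm_num) (by norm_num)]
  congr 1
  rw [gaussMeasure, lintegral_withDensity_eq_lintegral_mul_non_measurable _ (by fun_prop)
    (ae_of_all _ fun x => ENNReal.ofReal_lt_top)]
  refine lintegral_congr fun x => ?_
  have hw : ‖(weight σ x : ℂ)‖ₑ = ENNReal.ofReal (weight σ x) := by
    rw [← ofReal_norm, Complex.norm_real, Real.norm_of_nonneg (weight_nonneg σ x)]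
  rw [Pi.mul_apply, enorm_mul, ENNReal.mul_rpow_of_nonneg _ _ (by norm_num), hw, ← weight_sq]
  congr 1
  rw [ENNReal.ofReal_pow (weight_nonneg σ x)]
  simp

/-- The weight is continuous and never zero and the two measures have the same null sets, so
measurability passes both ways. -/
theorem memLp_gaussMeasure_iff {σ : ℝ} (hσ : 0 < σ) {h : ℝ → ℂ} :
    MemLp h 2 (gaussMeasure σ) ↔ MemLp (fun x => (weight σ x : ℂ) * h x) 2 := by
  unfold MemLp
  rw [eLpNorm_gaussMeasure]
  refine and_congr_left fun _ => ⟨fun hh => ?_, fun hh => ?_⟩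
  · exact (Complex.continuous_ofReal.comp (continuous_weight σ)).aestronglyMeasurable.mul
      (hh.mono_ac (volume_absolutelyContinuous_gaussMeasure hσ))
  · have h1 : AEStronglyMeasurable (fun x => ((weight σ x)⁻¹ : ℂ) * ((weight σ x : ℂ) * h x))
        volume := by
      refine AEStronglyMeasurable.mul (Continuous.aestronglyMeasurable ?_) hh
      exact (Complex.continuous_ofReal.comp (continuous_weight σ)).inv₀
        fun x => by simpa using (weight_pos hσ x).ne'
    refine AEStronglyMeasurable.mono_ac (gaussMeasure_absolutelyContinuous_volume σ) (h1.congr ?_)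
    refine ae_of_all _ fun x => ?_
    have : (weight σ x : ℂ) ≠ 0 := by simpa using (weight_pos hσ x).ne'
    simp only
    field_simp

/-! ### The scalar transform as chirp, Fourier transform, dilation, chirp -/

/-- The unimodular function `exp(-i σ κ x²)`. -/
def chirp (σ κ x : ℝ) : ℂ := Complex.exp (↑(-σ * κ * x ^ 2) * Complex.I)

theorem norm_chirp (σ κ x : ℝ) : ‖chirp σ κ x‖ = 1 := Complex.norm_exp_ofReal_mul_I _

theorem chirp_neg (σ κ x : ℝ) : chirp σ (-κ) x = (chirp σ κ x)⁻¹ := by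
  rw [chirp, chirp, ← Complex.exp_neg]
  congr 1
  push_cast
  ring

theorem continuous_chirp (σ κ : ℝ) : Continuous (chirp σ κ) := by
  unfold chirp; fun_prop

/-- The Gaussian kernel with `1 / (1 - a²) = 1 / 2 + i κ` and `a / (1 - a²) = i m`. -/
def chirpKernel (σ κ m x y : ℝ) : ℂ :=
  Complex.exp (-σ * (1 / 2 + κ * Complex.I) * x ^ 2 + 2 * σ * (m * Complex.I) * x * y
    - σ * (-1 / 2 + κ * Complex.I) * y ^ 2)

/-- The factor e^{-σy²/2} of the weight cancels the growth e^{σy²/2} of the kernel, and the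
remaining e^{-σx²/2} is the weight in `x`. -/
theorem weight_mul_chirpKernel (σ κ m x y : ℝ) :
    (weight σ y : ℂ) * chirpKernel σ κ m x y = weight σ x * chirp σ κ x * chirp σ κ y *
      Complex.exp (↑(2 * σ * m * x * y) * Complex.I) := by
  simp only [weight, chirp, chirpKernel]
  push_cast
  simp only [mul_assoc, ← Complex.exp_add]
  congr 2
  ring

theorem memLp_bounded_mul {u h : ℝ → ℂ} (hu : Continuous u) {C : ℝ} (hC : ∀ x, ‖u x‖ ≤ C)
    (hh : MemLp h 2) : MemLp (fun x => u x * h x) 2 :=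
  hh.of_le_mul (c := C) (hu.aestronglyMeasurable.mul hh.1)
    (ae_of_all _ fun x => by
      rw [norm_mul]; exact mul_le_mul_of_nonneg_right (hC x) (norm_nonneg _))

/-- The transform with kernel `p * chirpKernel σ κ m` is defined on all of `L²` of the Gaussian
measure, and its inverse is the transform with the conjugate parameters. -/
theorem exists_chirp_transform {σ : ℝ} (hσ : 0 < σ) {κ m : ℝ} (hm : m ≠ 0) {p q : ℂ}
    (hpq : q * p = ↑(σ * |m| / Real.pi)) {f : ℝ → ℂ} (hf : MemLp f 2 (gaussMeasure σ)) :
    ∃ g : ℝ → ℂ, MemLp g 2 (gaussMeasure σ) ∧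
      Tendsto (fun R : ℝ => eLpNorm (fun y =>
        p * (∫ x in Set.Icc (-R) R, f x * chirpKernel σ κ m x y) - g y) 2 (gaussMeasure σ))
        atTop (𝓝 0) ∧
      Tendsto (fun R : ℝ => eLpNorm (fun y =>
        q * (∫ x in Set.Icc (-R) R, g x * chirpKernel σ (-κ) (-m) x y) - f y) 2 (gaussMeasure σ))
        atTop (𝓝 0) := by
  have hw : ∀ x, (weight σ x : ℂ) ≠ 0 := fun x => by simpa using (weight_pos hσ x).ne'
  have hc : ∀ x, chirp σ κ x ≠ 0 := fun x => by
    rw [← norm_ne_zero_iff, norm_chirp]; exact one_ne_zero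
  have hπ := Real.pi_pos
  -- Chosen so that 2σm xy = -2πx(ly), the phase of the Fourier integral at frequency ly.
  set l : ℝ := -(σ * m / Real.pi) with hl_def
  have hl : l ≠ 0 := by
    rw [hl_def]; exact neg_ne_zero.2 (div_ne_zero (mul_ne_zero hσ.ne' hm) hπ.ne')
  have hlabs : |l| = σ * |m| / Real.pi := by
    rw [hl_def, abs_neg, abs_div, abs_mul, abs_of_pos hσ, abs_of_pos hπ]
  have hlm : ∀ x y : ℝ, 2 * σ * m * x * y = -2 * Real.pi * x * (l * y) := by
    intro x y; rw [hl_def]; field_simp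
  have hΦ : MemLp (fun x => chirp σ κ x * (weight σ x * f x)) 2 :=
    memLp_bounded_mul (continuous_chirp σ κ) (fun x => (norm_chirp σ κ x).le)
      ((memLp_gaussMeasure_iff hσ).1 hf)
  set F := hΦ.toLp _ with hF
  have hFae := hΦ.coeFn_toLp
  set G : Lp ℂ 2 (volume : Measure ℝ) := 𝓕 F with hG
  -- The image of f, with the weight divided out to return to the Gaussian space.
  refine ⟨fun y => (weight σ y : ℂ)⁻¹ * (p * chirp σ κ y * G (l * y)), ?_, ?_, ?_⟩
  · rw [memLp_gaussMeasure_iff hσ]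
    have h1 := memLp_comp_mul_left (Lp.memLp G) hl
    have h2 := memLp_bounded_mul (u := fun y => p * chirp σ κ y)
      (continuous_const.mul (continuous_chirp σ κ))
      (C := ‖p‖) (fun x => by rw [norm_mul, norm_chirp, mul_one]) h1
    refine h2.congr_norm ?_ (ae_of_all _ fun x => ?_)
    · refine h2.1.congr (ae_of_all _ fun x => ?_)
      simp only
      rw [mul_inv_cancel_left₀ (hw x)]
    · rw [mul_inv_cancel_left₀ (hw x)]
  · have h1 := tendsto_eLpNorm_fourier_truncation F
    have h2 : Tendsto (fun R : ℝ => ‖p‖ₑ * (ENNReal.ofReal |l⁻¹| ^ (1 / 2 : ℝ) *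
        eLpNorm (fun w => (∫ x in Set.Icc (-R) R,
        F x * Complex.exp (↑(-2 * Real.pi * x * w) * Complex.I)) - G w) 2 volume))
        atTop (𝓝 0) := by
      have := ENNReal.Tendsto.const_mul (a := ‖p‖ₑ) (ENNReal.Tendsto.const_mul
        (a := ENNReal.ofReal |l⁻¹| ^ (1 / 2 : ℝ)) h1 (Or.inr (by finiteness)))
        (Or.inr enorm_ne_top)
      simpa using this
    refine h2.congr fun R => ?_
    rw [← eLpNorm_comp_mul_left _ hl, ← eLpNorm_const_smul, eLpNorm_gaussMeasure]
    refine eLpNorm_congr_norm_ae (ae_of_all _ fun y => ?_)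
    have h3 : (weight σ y : ℂ) * (p * (∫ x in Set.Icc (-R) R, f x * chirpKernel σ κ m x y)
        - (weight σ y : ℂ)⁻¹ * (p * chirp σ κ y * G (l * y)))
        = chirp σ κ y * (p * ((∫ x in Set.Icc (-R) R,
        F x * Complex.exp (↑(-2 * Real.pi * x * (l * y)) * Complex.I)) - G (l * y))) := by
      have h4 : ∫ x in Set.Icc (-R) R,
          F x * Complex.exp (↑(-2 * Real.pi * x * (l * y)) * Complex.I)
          = (chirp σ κ y)⁻¹ * ((weight σ y : ℂ) *
            ∫ x in Set.Icc (-R) R, f x * chirpKernel σ κ m x y) := by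
        rw [← integral_const_mul, ← integral_const_mul]
        refine integral_congr_ae (ae_restrict_of_ae ?_)
        filter_upwards [hFae] with x hx
        rw [hF, hx, ← hlm, mul_left_comm (weight σ y : ℂ), weight_mul_chirpKernel]
        have := hc y
        field_simp
      rw [h4]
      have := hc y
      have := hw y
      field_simp
    rw [h3, norm_mul, norm_chirp, one_mul]
    rfl
  · have hGF : (𝓕⁻ G : Lp ℂ 2 (volume : Measure ℝ)) = F := FourierTransform.fourierInv_fourier_eq F
    have h1 := tendsto_eLpNorm_fourierInv_truncation G
    rw [hGF] at h1
    -- After u = lx, truncation to [-R, R] becomes truncation to [-|l|R, |l|R], which exhausts the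
    -- line as well.
    have h2 : Tendsto (fun R : ℝ => |l| * R) atTop atTop :=
      tendsto_id.const_mul_atTop (abs_pos.2 hl)
    refine (h1.comp h2).congr fun R => ?_
    simp only [Function.comp_apply]
    rw [eLpNorm_gaussMeasure]
    refine eLpNorm_congr_norm_ae ?_
    filter_upwards [hFae] with y hy
    have h4 : (weight σ y : ℂ) * ∫ x in Set.Icc (-R) R,
        ((weight σ x : ℂ)⁻¹ * (p * chirp σ κ x * G (l * x))) * chirpKernel σ (-κ) (-m) x y
        = p * (chirp σ κ y)⁻¹ * ∫ x in Set.Icc (-R) R,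
          G (l * x) * Complex.exp (↑(2 * Real.pi * (l * x) * y) * Complex.I) := by
      rw [← integral_const_mul, ← integral_const_mul]
      congr 1
      ext x
      rw [mul_left_comm, weight_mul_chirpKernel, chirp_neg, chirp_neg,
        show 2 * σ * (-m) * x * y = 2 * Real.pi * (l * x) * y by linarith [hlm x y]]
      have := hc x
      have := hw x
      field_simp
    have h5 := setIntegral_Icc_comp_mul_left
      (fun u => G u * Complex.exp (↑(2 * Real.pi * u * y) * Complex.I)) hl R
    have hl0 : ((|l| : ℝ) : ℂ) ≠ 0 := by simpa using hl
    have h6 : (weight σ y : ℂ) * (q * (∫ x in Set.Icc (-R) R,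
        ((weight σ x : ℂ)⁻¹ * (p * chirp σ κ x * G (l * x))) * chirpKernel σ (-κ) (-m) x y)
        - f y) = (chirp σ κ y)⁻¹ * ((∫ u in Set.Icc (-(|l| * R)) (|l| * R),
          G u * Complex.exp (↑(2 * Real.pi * u * y) * Complex.I)) - F y) := by
      -- Here qp = |l| cancels the Jacobian |l|⁻¹ of the substitution.
      rw [mul_sub, mul_left_comm, h4, h5, hF, hy, mul_assoc p, ← mul_assoc q, hpq, ← hlabs]
      have := hc y
      generalize (∫ u in Set.Icc (-(|l| * R)) (|l| * R),
        G u * Complex.exp (↑(2 * Real.pi * u * y) * Complex.I)) = J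
      push_cast
      field_simp
    rw [h6, norm_mul, norm_inv, norm_chirp, inv_one, one_mul]

/-! ### Parameters on the unit circle -/

/-- The idempotent component of `kernel`. -/
def compKernel (σ : ℝ) (a : ℂ) (x y : ℝ) : ℂ :=
  Complex.exp (-(σ * (1 - a ^ 2)⁻¹) * (x - a * y) ^ 2)

/-- The idempotent component of `prefactor`. -/
def compPrefactor (σ : ℝ) (a : ℂ) : ℂ := c0 σ * ((1 - a ^ 2) ^ (1 / 2 : ℂ))⁻¹

/-- A point of the unit circle other than 1 has real part below 1. This keeps 1 - a² off the branch
cut of the square root. -/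
theorem re_one_sub_sq_pos {a : ℂ} (ha : ‖a‖ = 1) (ha' : 1 - a ^ 2 ≠ 0) : 0 < (1 - a ^ 2).re := by
  have h1 : Complex.normSq (a ^ 2) = 1 := by
    rw [Complex.normSq_eq_norm_sq, norm_pow, ha]; norm_num
  rw [Complex.normSq_apply] at h1
  rcases lt_or_ge 0 (1 - a ^ 2).re with h | h
  · exact h
  · exfalso
    simp only [Complex.sub_re, Complex.one_re] at h
    have hre : (a ^ 2).re = 1 := by nlinarith [mul_self_nonneg (a ^ 2).im]
    have him : (a ^ 2).im = 0 := by rw [hre] at h1; nlinarith [mul_self_nonneg (a ^ 2).im]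
    exact ha' (by rw [show a ^ 2 = 1 from Complex.ext hre him, sub_self])

/-- The map w ↦ 1/(1 - w) sends the unit circle without 1 into the line Re = 1/2, since |1 - w|² =
2(1 - Re w) there. -/
theorem inv_one_sub_sq_eq {a : ℂ} (ha : ‖a‖ = 1) (ha' : 1 - a ^ 2 ≠ 0) :
    (1 - a ^ 2)⁻¹ = 1 / 2 + ((1 - a ^ 2)⁻¹.im : ℂ) * Complex.I := by
  have h1 : Complex.normSq (a ^ 2) = 1 := by
    rw [Complex.normSq_eq_norm_sq, norm_pow, ha]; norm_num
  have h0 : Complex.normSq (1 - a ^ 2) ≠ 0 := by simpa [Complex.normSq_eq_zero] using ha'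
  have h2 : (1 - a ^ 2)⁻¹.re = 1 / 2 := by
    rw [Complex.inv_re, div_eq_div_iff h0 two_ne_zero]
    rw [Complex.normSq_apply] at h1 ⊢
    simp only [Complex.sub_re, Complex.sub_im, Complex.one_re, Complex.one_im]
    linarith
  conv_lhs => rw [← Complex.re_add_im (1 - a ^ 2)⁻¹, h2]
  push_cast
  rfl

/-- As a⁻¹ is the conjugate of a, the quotient is 1/(a⁻¹ - a), which conjugation negates. -/
theorem mul_inv_one_sub_sq_eq {a : ℂ} (ha : ‖a‖ = 1) (ha' : 1 - a ^ 2 ≠ 0) :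
    a * (1 - a ^ 2)⁻¹ = ((a * (1 - a ^ 2)⁻¹).im : ℂ) * Complex.I := by
  have h1 : a * (starRingEnd ℂ) a = 1 := by
    rw [Complex.mul_conj, Complex.normSq_eq_norm_sq, ha]; norm_num
  have ha0 : a ≠ 0 := by rintro rfl; simp at ha
  have hconj : (starRingEnd ℂ) a = a⁻¹ := eq_inv_of_mul_eq_one_right h1
  have h2 : (starRingEnd ℂ) (a * (1 - a ^ 2)⁻¹) = -(a * (1 - a ^ 2)⁻¹) := by
    rw [map_mul, map_inv₀, map_sub, map_pow, map_one, hconj]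
    have h3 : a ^ 2 - 1 ≠ 0 := by
      rw [← neg_sub]; exact neg_ne_zero.2 ha'
    have h4 : 1 - a⁻¹ ^ 2 = -(a⁻¹ ^ 2 * (1 - a ^ 2)) := by field_simp; ring
    rw [h4]
    field_simp
  have h3 : (a * (1 - a ^ 2)⁻¹).re = 0 := by
    have := congrArg Complex.re h2
    rw [Complex.conj_re, Complex.neg_re] at this
    linarith
  conv_lhs => rw [← Complex.re_add_im (a * (1 - a ^ 2)⁻¹), h3]
  simp

theorem compKernel_eq_chirpKernel (σ : ℝ) {a : ℂ} (ha' : 1 - a ^ 2 ≠ 0) {κ m : ℝ}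
    (hκ : (1 - a ^ 2)⁻¹ = 1 / 2 + κ * Complex.I) (hm : a * (1 - a ^ 2)⁻¹ = m * Complex.I)
    (x y : ℝ) : compKernel σ a x y = chirpKernel σ κ m x y := by
  have h3 : a ^ 2 * (1 - a ^ 2)⁻¹ = -1 / 2 + κ * Complex.I := by
    have : a ^ 2 * (1 - a ^ 2)⁻¹ = (1 - a ^ 2)⁻¹ - 1 := by field_simp; ring
    rw [this, hκ]; ring
  rw [compKernel, chirpKernel, ← hκ, ← hm, ← h3]
  congr 1
  ring

theorem conj_one_half : (starRingEnd ℂ) (1 / 2 : ℂ) = 1 / 2 := by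
  rw [map_div₀, map_one, Complex.conj_ofNat]

theorem compPrefactor_conj (σ : ℝ) {a : ℂ} (ha : ‖a‖ = 1) (ha' : 1 - a ^ 2 ≠ 0) :
    compPrefactor σ ((starRingEnd ℂ) a) = (starRingEnd ℂ) (compPrefactor σ a) := by
  have harg : (1 - a ^ 2).arg ≠ Real.pi := by
    rw [Ne, Complex.arg_eq_pi_iff]
    exact fun h => (re_one_sub_sq_pos ha ha').not_gt h.1
  have h := Complex.conj_cpow (1 - a ^ 2) (1 / 2) harg
  rw [compPrefactor, compPrefactor, map_mul, Complex.conj_ofReal, map_inv₀,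
    ← map_pow, ← map_one (starRingEnd ℂ), ← map_sub, map_one, h, conj_one_half]

/-- The product is |p|² = c₀²/|1 - a²| with c₀² = σ/π; the factor |a| = 1 is inserted to exhibit
|m|. -/
theorem compPrefactor_conj_mul_self {σ : ℝ} (hσ : 0 < σ) {a : ℂ} (ha : ‖a‖ = 1)
    (ha' : 1 - a ^ 2 ≠ 0) :
    compPrefactor σ ((starRingEnd ℂ) a) * compPrefactor σ a
      = ↑(σ * ‖a * (1 - a ^ 2)⁻¹‖ / Real.pi) := by
  rw [compPrefactor_conj σ ha ha', mul_comm, Complex.mul_conj, Complex.normSq_eq_norm_sq]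
  congr 1
  have h1 : ‖(1 - a ^ 2) ^ (1 / 2 : ℂ)‖ ^ 2 = ‖1 - a ^ 2‖ := by
    rw [← norm_pow, ← Complex.cpow_nat_mul]
    norm_num
  rw [compPrefactor, norm_mul, mul_pow, norm_inv, inv_pow, h1, Complex.norm_real,
    Real.norm_of_nonneg (c0_nonneg σ), c0, Real.sq_sqrt (by positivity), norm_mul, ha, norm_inv]
  ring

theorem one_sub_conj_sq_ne_zero {a : ℂ} (ha' : 1 - a ^ 2 ≠ 0) :
    1 - (starRingEnd ℂ) a ^ 2 ≠ 0 := by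
  have : (starRingEnd ℂ) (1 - a ^ 2) ≠ 0 := (map_ne_zero _).2 ha'
  simpa using this

/-- The fractional Fourier transform of an idempotent component and its inverse. -/
theorem exists_comp_transform {σ : ℝ} (hσ : 0 < σ) {a : ℂ} (ha : ‖a‖ = 1)
    (ha' : 1 - a ^ 2 ≠ 0) {f : ℝ → ℂ} (hf : MemLp f 2 (gaussMeasure σ)) :
    ∃ g : ℝ → ℂ, MemLp g 2 (gaussMeasure σ) ∧
      Tendsto (fun R : ℝ => eLpNorm (fun y => compPrefactor σ a *
        (∫ x in Set.Icc (-R) R, f x * compKernel σ a x y) - g y) 2 (gaussMeasure σ))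
        atTop (𝓝 0) ∧
      Tendsto (fun R : ℝ => eLpNorm (fun y => compPrefactor σ ((starRingEnd ℂ) a) *
        (∫ x in Set.Icc (-R) R, g x * compKernel σ ((starRingEnd ℂ) a) x y) - f y) 2
        (gaussMeasure σ)) atTop (𝓝 0) := by
  have hκ := inv_one_sub_sq_eq ha ha'
  have hm := mul_inv_one_sub_sq_eq ha ha'
  have hpq := compPrefactor_conj_mul_self hσ ha ha'
  have hne : a * (1 - a ^ 2)⁻¹ ≠ 0 :=
    mul_ne_zero (by rintro rfl; simp at ha) (inv_ne_zero ha')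
  generalize (1 - a ^ 2)⁻¹.im = κ at hκ
  generalize (a * (1 - a ^ 2)⁻¹).im = m at hm
  have hm0 : m ≠ 0 := by rintro rfl; simp [hm] at hne
  have hnorm : ‖a * (1 - a ^ 2)⁻¹‖ = |m| := by rw [hm]; simp
  rw [hnorm] at hpq
  have hκ' : (1 - (starRingEnd ℂ) a ^ 2)⁻¹ = 1 / 2 + ((-κ : ℝ) : ℂ) * Complex.I := by
    have := congrArg (starRingEnd ℂ) hκ
    rw [map_add, conj_one_half] at this
    simpa using this
  have hm' : (starRingEnd ℂ) a * (1 - (starRingEnd ℂ) a ^ 2)⁻¹ = ((-m : ℝ) : ℂ) * Complex.I := by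
    have := congrArg (starRingEnd ℂ) hm
    simpa using this
  simp only [compKernel_eq_chirpKernel σ ha' hκ hm,
    compKernel_eq_chirpKernel σ (one_sub_conj_sq_ne_zero ha') hκ' hm']
  exact exists_chirp_transform hσ hm0 hpq hf

/-! ### Idempotent components -/

@[simp] theorem plus_add (Z W : Bicomplex) : (Z + W).plus = Z.plus + W.plus := by
  simp [plus]; ring

@[simp] theorem minus_add (Z W : Bicomplex) : (Z + W).minus = Z.minus + W.minus := by
  simp [minus]; ring

@[simp] theorem plus_mul (Z W : Bicomplex) : (Z * W).plus = Z.plus * W.plus := by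
  simp only [plus, QuadraticAlgebra.re_mul, QuadraticAlgebra.im_mul]
  linear_combination (-(Z.im * W.im)) * Complex.I_sq

@[simp] theorem minus_mul (Z W : Bicomplex) : (Z * W).minus = Z.minus * W.minus := by
  simp only [minus, QuadraticAlgebra.re_mul, QuadraticAlgebra.im_mul]
  linear_combination (-(Z.im * W.im)) * Complex.I_sq

@[simp] theorem plus_one : (1 : Bicomplex).plus = 1 := by
  simp [plus, QuadraticAlgebra.re_one, QuadraticAlgebra.im_one]

@[simp] theorem minus_one : (1 : Bicomplex).minus = 1 := by
  simp [minus, QuadraticAlgebra.re_one, QuadraticAlgebra.im_one]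

@[simp] theorem plus_neg (Z : Bicomplex) : (-Z).plus = -Z.plus := by simp [plus]; ring

@[simp] theorem minus_neg (Z : Bicomplex) : (-Z).minus = -Z.minus := by simp [minus]; ring

@[simp] theorem plus_sub (Z W : Bicomplex) : (Z - W).plus = Z.plus - W.plus := by
  rw [sub_eq_add_neg, plus_add, plus_neg, sub_eq_add_neg]

@[simp] theorem minus_sub (Z W : Bicomplex) : (Z - W).minus = Z.minus - W.minus := by
  rw [sub_eq_add_neg, minus_add, minus_neg, sub_eq_add_neg]

@[simp] theorem plus_sq (Z : Bicomplex) : (Z ^ 2).plus = Z.plus ^ 2 := by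
  rw [sq, plus_mul, sq]

@[simp] theorem minus_sq (Z : Bicomplex) : (Z ^ 2).minus = Z.minus ^ 2 := by
  rw [sq, minus_mul, sq]

@[simp] theorem plus_ofIdem (α β : ℂ) : (ofIdem α β).plus = α := by
  simp only [plus, ofIdem, ePlus, eMinus, QuadraticAlgebra.re_add, QuadraticAlgebra.im_add,
    QuadraticAlgebra.re_smul, QuadraticAlgebra.im_smul, smul_eq_mul]
  linear_combination (-(α / 2) + β / 2) * Complex.I_sq

@[simp] theorem minus_ofIdem (α β : ℂ) : (ofIdem α β).minus = β := by
  simp only [minus, ofIdem, ePlus, eMinus, QuadraticAlgebra.re_add, QuadraticAlgebra.im_add,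
    QuadraticAlgebra.re_smul, QuadraticAlgebra.im_smul, smul_eq_mul]
  linear_combination ((α / 2) - β / 2) * Complex.I_sq

@[simp] theorem plus_ofReal (x : ℝ) : (ofReal x).plus = x := by
  have h1 : (ofReal x).re = x := rfl
  have h2 : (ofReal x).im = 0 := rfl
  simp [plus, h1, h2]

@[simp] theorem minus_ofReal (x : ℝ) : (ofReal x).minus = x := by
  have h1 : (ofReal x).re = x := rfl
  have h2 : (ofReal x).im = 0 := rfl
  simp [minus, h1, h2]

@[simp] theorem plus_conjStar (Z : Bicomplex) : Z.conjStar.plus = (starRingEnd ℂ) Z.plus := by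
  simp [plus, conjStar]

@[simp] theorem minus_conjStar (Z : Bicomplex) : Z.conjStar.minus = (starRingEnd ℂ) Z.minus := by
  simp [minus, conjStar]

theorem ext_idem {Z W : Bicomplex} (h1 : Z.plus = W.plus) (h2 : Z.minus = W.minus) : Z = W := by
  simp only [plus, minus] at h1 h2
  refine QuadraticAlgebra.ext ?_ ?_
  · linear_combination (h1 + h2) / 2
  · have : Complex.I * Z.im = Complex.I * W.im := by linear_combination (h2 - h1) / 2
    exact mul_left_cancel₀ Complex.I_ne_zero this

theorem conjStar_conjStar (Z : Bicomplex) : Z.conjStar.conjStar = Z :=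
  ext_idem (by simp) (by simp)

theorem isUnit_iff_idem {Z : Bicomplex} : IsUnit Z ↔ Z.plus ≠ 0 ∧ Z.minus ≠ 0 := by
  constructor
  · intro h
    obtain ⟨W, hW⟩ := h.exists_right_inv
    have h1 := congrArg plus hW
    have h2 := congrArg minus hW
    rw [plus_mul, plus_one] at h1
    rw [minus_mul, minus_one] at h2
    exact ⟨left_ne_zero_of_mul_eq_one h1, left_ne_zero_of_mul_eq_one h2⟩
  · rintro ⟨h1, h2⟩
    exact IsUnit.of_mul_eq_one (ofIdem Z.plus⁻¹ Z.minus⁻¹)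
      (ext_idem (by simp [h1]) (by simp [h2]))

theorem plus_inverse {Z : Bicomplex} (hZ : IsUnit Z) : (Ring.inverse Z).plus = Z.plus⁻¹ := by
  have h := congrArg plus (Ring.mul_inverse_cancel Z hZ)
  rw [plus_mul, plus_one] at h
  exact eq_inv_of_mul_eq_one_right h

theorem minus_inverse {Z : Bicomplex} (hZ : IsUnit Z) : (Ring.inverse Z).minus = Z.minus⁻¹ := by
  have h := congrArg minus (Ring.mul_inverse_cancel Z hZ)
  rw [minus_mul, minus_one] at h
  exact eq_inv_of_mul_eq_one_right h

theorem isUnit_sqrt {Z : Bicomplex} (hZ : IsUnit Z) : IsUnit (sqrt Z) := by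
  rw [isUnit_iff_idem] at hZ ⊢
  simp only [sqrt, plus_ofIdem, minus_ofIdem, ne_eq, Complex.cpow_eq_zero_iff]
  tauto

theorem plus_prefactor (σ : ℝ) {θ : Bicomplex} (hθ : IsUnit (1 - θ ^ 2)) :
    (prefactor σ θ).plus = compPrefactor σ θ.plus := by
  rw [prefactor, plus_mul, plus_inverse (isUnit_sqrt hθ)]
  simp [sqrt, compPrefactor]

theorem minus_prefactor (σ : ℝ) {θ : Bicomplex} (hθ : IsUnit (1 - θ ^ 2)) :
    (prefactor σ θ).minus = compPrefactor σ θ.minus := by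
  rw [prefactor, minus_mul, minus_inverse (isUnit_sqrt hθ)]
  simp [sqrt, compPrefactor]

theorem plus_kernel (σ : ℝ) {θ : Bicomplex} (hθ : IsUnit (1 - θ ^ 2)) (x y : ℝ) :
    (kernel σ θ x y).plus = compKernel σ θ.plus x y := by
  simp [kernel, exp, compKernel, plus_inverse hθ]

theorem minus_kernel (σ : ℝ) {θ : Bicomplex} (hθ : IsUnit (1 - θ ^ 2)) (x y : ℝ) :
    (kernel σ θ x y).minus = compKernel σ θ.minus x y := by
  simp [kernel, exp, compKernel, minus_inverse hθ]

theorem isUnit_one_sub_conjStar_sq {θ : Bicomplex} (hθ : IsUnit (1 - θ ^ 2)) :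
    IsUnit (1 - θ.conjStar ^ 2) := by
  rw [isUnit_iff_idem] at hθ ⊢
  simp only [plus_sub, plus_one, plus_sq, minus_sub, minus_one, minus_sq, plus_conjStar,
    minus_conjStar] at hθ ⊢
  exact ⟨one_sub_conj_sq_ne_zero hθ.1, one_sub_conj_sq_ne_zero hθ.2⟩

theorem norm_plus_of_mem_unitTorus {θ : Bicomplex} (hθ : θ ∈ unitTorus) :
    ‖θ.plus‖ = 1 ∧ ‖θ.minus‖ = 1 := by
  obtain ⟨a, b, ha, hb, rfl⟩ := hθ
  simp [ha, hb]

theorem conjStar_mem_unitTorus {θ : Bicomplex} (hθ : θ ∈ unitTorus) : θ.conjStar ∈ unitTorus := by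
  obtain ⟨h1, h2⟩ := norm_plus_of_mem_unitTorus hθ
  exact ⟨(starRingEnd ℂ) θ.plus, (starRingEnd ℂ) θ.minus, by simpa using h1, by simpa using h2,
    ext_idem (by simp) (by simp)⟩

/-! ### Topology -/

instance : FiniteDimensional ℝ Bicomplex :=
  FiniteDimensional.of_injective toEuclid toEuclid_injective

instance : CompleteSpace Bicomplex := FiniteDimensional.complete ℝ Bicomplex

/-- The idempotent components as a real linear equivalence onto `ℂ × ℂ`. -/
def idemEquiv : Bicomplex ≃ₗ[ℝ] ℂ × ℂ where
  toFun Z := (Z.plus, Z.minus)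
  invFun p := ofIdem p.1 p.2
  map_add' Z W := by simp
  map_smul' r Z := by
    ext1 <;> simp [plus, minus] <;> ring
  left_inv Z := ext_idem (by simp) (by simp)
  right_inv p := by simp

/-- The component `plus` as a continuous linear map. -/
def plusL : Bicomplex →L[ℝ] ℂ :=
  (ContinuousLinearMap.fst ℝ ℂ ℂ).comp (idemEquiv.toContinuousLinearEquiv : Bicomplex →L[ℝ] ℂ × ℂ)

/-- The component `minus` as a continuous linear map. -/
def minusL : Bicomplex →L[ℝ] ℂ :=
  (ContinuousLinearMap.snd ℝ ℂ ℂ).comp (idemEquiv.toContinuousLinearEquiv : Bicomplex →L[ℝ] ℂ × ℂ)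

@[simp] theorem plusL_apply (Z : Bicomplex) : plusL Z = Z.plus := rfl

@[simp] theorem minusL_apply (Z : Bicomplex) : minusL Z = Z.minus := rfl

theorem continuous_ofIdem : Continuous fun p : ℂ × ℂ => ofIdem p.1 p.2 :=
  idemEquiv.toContinuousLinearEquiv.symm.continuous

/-- Proved on components: the Euclidean norm is not submultiplicative (e₊² = e₊ has norm 1/√2), so
no normed ring structure is at hand. -/
theorem continuous_const_mul (Z : Bicomplex) : Continuous fun W : Bicomplex => Z * W := by
  have : (fun W : Bicomplex => Z * W)
      = fun W => ofIdem (Z.plus * plusL W) (Z.minus * minusL W) := by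
    ext1 W
    exact ext_idem (by simp) (by simp)
  rw [this]
  exact continuous_ofIdem.comp ((continuous_const.mul plusL.continuous).prodMk
    (continuous_const.mul minusL.continuous))

theorem norm_le_norm_plus_add_norm_minus (Z : Bicomplex) : ‖Z‖ ≤ ‖Z.plus‖ + ‖Z.minus‖ := by
  have h : ‖Z‖ = ‖toEuclid Z‖ := rfl
  have h2 : ‖Z‖ ^ 2 = ‖Z.re‖ ^ 2 + ‖Z.im‖ ^ 2 := by
    rw [h, WithLp.prod_norm_sq_eq_of_L2]; rfl
  have h3 : ‖Z.plus‖ ^ 2 + ‖Z.minus‖ ^ 2 = 2 * (‖Z.re‖ ^ 2 + ‖Z.im‖ ^ 2) := by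
    simp only [← Complex.normSq_eq_norm_sq, Complex.normSq_apply, plus, minus, Complex.sub_re,
      Complex.sub_im, Complex.add_re, Complex.add_im, Complex.mul_re, Complex.mul_im,
      Complex.I_re, Complex.I_im]
    ring
  refine le_of_sq_le_sq ?_ (by positivity)
  nlinarith [norm_nonneg Z.plus, norm_nonneg Z.minus, norm_nonneg Z]

/-! ### The transform -/

theorem continuous_compKernel (σ : ℝ) (a : ℂ) :
    Continuous fun z : ℝ × ℝ => compKernel σ a z.1 z.2 := by
  unfold compKernel; fun_prop

theorem mul_kernel_eq (σ : ℝ) {θ : Bicomplex} (hθ : IsUnit (1 - θ ^ 2)) (Z : Bicomplex)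
    (x y : ℝ) : Z * kernel σ θ x y =
      ofIdem (plusL Z * compKernel σ θ.plus x y) (minusL Z * compKernel σ θ.minus x y) :=
  ext_idem (by simp [plus_kernel σ hθ]) (by simp [minus_kernel σ hθ])

/-- The weight is bounded below on compact intervals, so Gaussian square integrability gives local
integrability. -/
theorem integrableOn_of_memLp_gaussMeasure {σ : ℝ} (hσ : 0 < σ) {f : ℝ → ℂ}
    (hf : MemLp f 2 (gaussMeasure σ)) (R : ℝ) : IntegrableOn f (Set.Icc (-R) R) := by
  have hw : ∀ x, (weight σ x : ℂ) ≠ 0 := fun x => by simpa using (weight_pos hσ x).ne'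
  have h1 : IntegrableOn (fun x => (weight σ x : ℂ) * f x) (Set.Icc (-R) R) :=
    (((memLp_gaussMeasure_iff hσ).1 hf).restrict _).integrable (by norm_num)
  have h2 := h1.continuousOn_mul (g := fun x => (weight σ x : ℂ)⁻¹)
    (((Complex.continuous_ofReal.comp (continuous_weight σ)).inv₀ hw).continuousOn) isCompact_Icc
  refine h2.congr_fun (fun x _ => ?_) measurableSet_Icc
  simp only
  rw [inv_mul_cancel_left₀ (hw x)]

theorem memLp_plus {σ : ℝ} (ψ : L2 σ) : MemLp (fun x => plusL (ψ x)) 2 (gaussMeasure σ) :=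
  plusL.comp_memLp ψ

theorem memLp_minus {σ : ℝ} (ψ : L2 σ) : MemLp (fun x => minusL (ψ x)) 2 (gaussMeasure σ) :=
  minusL.comp_memLp ψ

theorem integrableOn_mul_kernel {σ : ℝ} (hσ : 0 < σ) {θ : Bicomplex} (hθ : IsUnit (1 - θ ^ 2))
    (ψ : L2 σ) (y R : ℝ) : IntegrableOn (fun x => ψ x * kernel σ θ x y) (Set.Icc (-R) R) := by
  simp only [mul_kernel_eq σ hθ]
  have hk : ∀ a, ContinuousOn (fun x => compKernel σ a x y) (Set.Icc (-R) R) := fun a =>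
    ((continuous_compKernel σ a).comp (Continuous.prodMk_left y)).continuousOn
  have h1 := (integrableOn_of_memLp_gaussMeasure hσ (memLp_plus ψ) R).mul_continuousOn
    (hk θ.plus) isCompact_Icc
  have h2 := (integrableOn_of_memLp_gaussMeasure hσ (memLp_minus ψ) R).mul_continuousOn
    (hk θ.minus) isCompact_Icc
  exact (idemEquiv.toContinuousLinearEquiv.symm : ℂ × ℂ →L[ℝ] Bicomplex).integrable_comp
    (h1.prodMk h2)

/-- The fractional Fourier transform truncated to `[-R, R]`. -/
def truncated (σ : ℝ) (θ : Bicomplex) (ψ : L2 σ) (R y : ℝ) : Bicomplex :=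
  prefactor σ θ * ∫ x in Set.Icc (-R) R, ψ x * kernel σ θ x y

theorem plus_truncated {σ : ℝ} (hσ : 0 < σ) {θ : Bicomplex} (hθ : IsUnit (1 - θ ^ 2))
    (ψ : L2 σ) (R y : ℝ) : (truncated σ θ ψ R y).plus = compPrefactor σ θ.plus *
      ∫ x in Set.Icc (-R) R, plusL (ψ x) * compKernel σ θ.plus x y := by
  rw [truncated, plus_mul, plus_prefactor σ hθ, ← plusL_apply (∫ _ in _, _),
    ← plusL.integral_comp_comm (integrableOn_mul_kernel hσ hθ ψ y R)]
  simp [plus_kernel σ hθ]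

theorem minus_truncated {σ : ℝ} (hσ : 0 < σ) {θ : Bicomplex} (hθ : IsUnit (1 - θ ^ 2))
    (ψ : L2 σ) (R y : ℝ) : (truncated σ θ ψ R y).minus = compPrefactor σ θ.minus *
      ∫ x in Set.Icc (-R) R, minusL (ψ x) * compKernel σ θ.minus x y := by
  rw [truncated, minus_mul, minus_prefactor σ hθ, ← minusL_apply (∫ _ in _, _),
    ← minusL.integral_comp_comm (integrableOn_mul_kernel hσ hθ ψ y R)]
  simp [minus_kernel σ hθ]

/-- The integrand is jointly measurable, so integrating out `x` leaves a measurable function of `y`.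
-/
theorem aestronglyMeasurable_comp_truncated {σ : ℝ} (hσ : 0 < σ) {f : ℝ → ℂ}
    (hf : MemLp f 2 (gaussMeasure σ)) (a : ℂ) (R : ℝ) :
    AEStronglyMeasurable (fun y => compPrefactor σ a *
      ∫ x in Set.Icc (-R) R, f x * compKernel σ a x y) (gaussMeasure σ) := by
  refine AEStronglyMeasurable.mono_ac (gaussMeasure_absolutelyContinuous_volume σ) ?_
  refine aestronglyMeasurable_const.mul ?_
  have h1 : AEStronglyMeasurable f (volume.restrict (Set.Icc (-R) R)) :=
    (integrableOn_of_memLp_gaussMeasure hσ hf R).1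
  have h2 : AEStronglyMeasurable (fun z : ℝ × ℝ => f z.2 * compKernel σ a z.2 z.1)
      (volume.prod (volume.restrict (Set.Icc (-R) R))) :=
    h1.comp_snd.mul
      ((continuous_compKernel σ a).comp continuous_swap).aestronglyMeasurable
  exact h2.integral_prod_right'

theorem aestronglyMeasurable_truncated {σ : ℝ} (hσ : 0 < σ) {θ : Bicomplex}
    (hθ : IsUnit (1 - θ ^ 2)) (ψ : L2 σ) (R : ℝ) :
    AEStronglyMeasurable (truncated σ θ ψ R) (gaussMeasure σ) := by
  have h := continuous_ofIdem.comp_aestronglyMeasurable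
    ((aestronglyMeasurable_comp_truncated hσ (memLp_plus ψ) θ.plus R).prodMk
      (aestronglyMeasurable_comp_truncated hσ (memLp_minus ψ) θ.minus R))
  refine h.congr (ae_of_all _ fun y => ?_)
  exact ext_idem (by simp [plus_truncated hσ hθ]) (by simp [minus_truncated hσ hθ])

/-- The transform may be computed on the idempotent components. -/
theorem hasBFrFT_of_comp {σ : ℝ} (hσ : 0 < σ) {θ : Bicomplex} (hθ : IsUnit (1 - θ ^ 2))
    {ψ g : L2 σ} {f₁ f₂ g₁ g₂ : ℝ → ℂ}
    (hf₁ : (fun x => plusL (ψ x)) =ᵐ[gaussMeasure σ] f₁)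
    (hf₂ : (fun x => minusL (ψ x)) =ᵐ[gaussMeasure σ] f₂)
    (hg₁ : (fun x => plusL (g x)) =ᵐ[gaussMeasure σ] g₁)
    (hg₂ : (fun x => minusL (g x)) =ᵐ[gaussMeasure σ] g₂)
    (h₁ : Tendsto (fun R : ℝ => eLpNorm (fun y => compPrefactor σ θ.plus *
        (∫ x in Set.Icc (-R) R, f₁ x * compKernel σ θ.plus x y) - g₁ y) 2 (gaussMeasure σ))
        atTop (𝓝 0))
    (h₂ : Tendsto (fun R : ℝ => eLpNorm (fun y => compPrefactor σ θ.minus *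
        (∫ x in Set.Icc (-R) R, f₂ x * compKernel σ θ.minus x y) - g₂ y) 2 (gaussMeasure σ))
        atTop (𝓝 0)) :
    HasBFrFT σ θ ψ g := by
  -- The almost everywhere equalities are Gaussian, while the inner integrals are taken against
  -- Lebesgue measure.
  have hac := volume_absolutelyContinuous_gaussMeasure hσ
  refine tendsto_of_tendsto_of_tendsto_of_le_of_le tendsto_const_nhds
    (by simpa using h₁.add h₂) (fun _ => zero_le) fun R => ?_
  have hm : AEStronglyMeasurable (fun y => truncated σ θ ψ R y - g y) (gaussMeasure σ) :=
    (aestronglyMeasurable_truncated hσ hθ ψ R).sub (Lp.aestronglyMeasurable g)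
  calc eLpNorm (fun y => truncated σ θ ψ R y - g y) 2 (gaussMeasure σ)
      ≤ eLpNorm (fun y => ‖plusL (truncated σ θ ψ R y - g y)‖
          + ‖minusL (truncated σ θ ψ R y - g y)‖) 2 (gaussMeasure σ) :=
        eLpNorm_mono_real fun y => norm_le_norm_plus_add_norm_minus _
    _ ≤ eLpNorm (fun y => ‖plusL (truncated σ θ ψ R y - g y)‖) 2 (gaussMeasure σ)
          + eLpNorm (fun y => ‖minusL (truncated σ θ ψ R y - g y)‖) 2 (gaussMeasure σ) :=
        eLpNorm_add_le (plusL.continuous.comp_aestronglyMeasurable hm).norm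
          (minusL.continuous.comp_aestronglyMeasurable hm).norm (by norm_num)
    _ = _ := by
        rw [eLpNorm_norm, eLpNorm_norm]
        congr 1
        · refine eLpNorm_congr_ae ?_
          filter_upwards [hg₁] with y hy
          rw [map_sub, hy, plusL_apply, plus_truncated hσ hθ]
          congr 2
          refine integral_congr_ae (ae_restrict_of_ae ?_)
          filter_upwards [hac.ae_le hf₁] with x hx
          rw [hx]
        · refine eLpNorm_congr_ae ?_
          filter_upwards [hg₂] with y hy
          rw [map_sub, hy, minusL_apply, minus_truncated hσ hθ]
          congr 2
          refine integral_congr_ae (ae_restrict_of_ae ?_)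
          filter_upwards [hac.ae_le hf₂] with x hx
          rw [hx]

theorem memLp_ofIdem {μ : Measure ℝ} {g₁ g₂ : ℝ → ℂ} (hg₁ : MemLp g₁ 2 μ) (hg₂ : MemLp g₂ 2 μ) :
    MemLp (fun y => ofIdem (g₁ y) (g₂ y)) 2 μ :=
  (idemEquiv.toContinuousLinearEquiv.symm : ℂ × ℂ →L[ℝ] Bicomplex).comp_memLp'
    (f := fun y => (g₁ y, g₂ y)) (memLp_prod_iff.2 ⟨hg₁, hg₂⟩)

/-- Every `ψ` has a transform, whose transform with the conjugate parameter is `ψ`. -/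
theorem exists_hasBFrFT {σ : ℝ} (hσ : 0 < σ) {θ : Bicomplex} (hθ : θ ∈ unitTorus)
    (hθ' : IsUnit (1 - θ ^ 2)) (ψ : L2 σ) :
    ∃ g : L2 σ, HasBFrFT σ θ ψ g ∧ HasBFrFT σ θ.conjStar g ψ := by
  obtain ⟨ha, hb⟩ := norm_plus_of_mem_unitTorus hθ
  have hne := isUnit_iff_idem.1 hθ'
  simp only [plus_sub, plus_one, plus_sq, minus_sub, minus_one, minus_sq] at hne
  obtain ⟨g₁, hg₁, h₁, h₁'⟩ := exists_comp_transform hσ ha hne.1 (memLp_plus ψ)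
  obtain ⟨g₂, hg₂, h₂, h₂'⟩ := exists_comp_transform hσ hb hne.2 (memLp_minus ψ)
  have hg : MemLp (fun y => ofIdem (g₁ y) (g₂ y)) 2 (gaussMeasure σ) :=
    memLp_ofIdem hg₁ hg₂
  have e₁ : (fun x => plusL (hg.toLp _ x)) =ᵐ[gaussMeasure σ] g₁ := by
    filter_upwards [hg.coeFn_toLp] with x hx
    rw [hx, plusL_apply, plus_ofIdem]
  have e₂ : (fun x => minusL (hg.toLp _ x)) =ᵐ[gaussMeasure σ] g₂ := by
    filter_upwards [hg.coeFn_toLp] with x hx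
    rw [hx, minusL_apply, minus_ofIdem]
  refine ⟨hg.toLp _, hasBFrFT_of_comp hσ hθ' .rfl .rfl e₁ e₂ h₁ h₂,
    hasBFrFT_of_comp hσ (isUnit_one_sub_conjStar_sq hθ') e₁ e₂ .rfl .rfl ?_ ?_⟩
  · simpa only [plus_conjStar] using h₁'
  · simpa only [minus_conjStar] using h₂'

/-! ### Uniqueness, inversion and the pointwise formula -/

theorem HasBFrFT.tendstoInMeasure {σ : ℝ} (hσ : 0 < σ) {θ : Bicomplex} (hθ : IsUnit (1 - θ ^ 2))
    {ψ g : L2 σ} (h : HasBFrFT σ θ ψ g) :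
    TendstoInMeasure (gaussMeasure σ) (truncated σ θ ψ) atTop g :=
  tendstoInMeasure_of_tendsto_eLpNorm two_ne_zero (aestronglyMeasurable_truncated hσ hθ ψ)
    (Lp.aestronglyMeasurable g) h

theorem HasBFrFT.unique {σ : ℝ} (hσ : 0 < σ) {θ : Bicomplex} (hθ : IsUnit (1 - θ ^ 2))
    {ψ g g' : L2 σ} (h : HasBFrFT σ θ ψ g) (h' : HasBFrFT σ θ ψ g') : g = g' :=
  Lp.ext (tendstoInMeasure_ae_unique (h.tendstoInMeasure hσ hθ) (h'.tendstoInMeasure hσ hθ))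

theorem hasBFrFT_bfrft {σ : ℝ} (hσ : 0 < σ) {θ : Bicomplex} (hθ : θ ∈ unitTorus)
    (hθ' : IsUnit (1 - θ ^ 2)) (ψ : L2 σ) : HasBFrFT σ θ ψ (bfrft σ θ ψ) := by
  have h : ∃ g : L2 σ, HasBFrFT σ θ ψ g := (exists_hasBFrFT hσ hθ hθ' ψ).imp fun _ hg => hg.1
  rw [bfrft, dif_pos h]
  exact h.choose_spec

theorem bfrft_conjStar_bfrft {σ : ℝ} (hσ : 0 < σ) {θ : Bicomplex} (hθ : θ ∈ unitTorus)
    (hθ' : IsUnit (1 - θ ^ 2)) (ψ : L2 σ) : bfrft σ θ.conjStar (bfrft σ θ ψ) = ψ := by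
  obtain ⟨g, hg, hg'⟩ := exists_hasBFrFT hσ hθ hθ' ψ
  rw [(hasBFrFT_bfrft hσ hθ hθ' ψ).unique hσ hθ' hg]
  have hc := isUnit_one_sub_conjStar_sq hθ'
  exact (hasBFrFT_bfrft hσ (conjStar_mem_unitTorus hθ) hc g).unique hσ hc hg'

/-- Where the integral converges absolutely, it gives the transform. -/
theorem bfrft_ae_eq_of_integrable {σ : ℝ} (hσ : 0 < σ) {θ : Bicomplex} (hθ : θ ∈ unitTorus)
    (hθ' : IsUnit (1 - θ ^ 2)) (ψ : L2 σ) :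
    ∀ᵐ y : ℝ, Integrable (fun x : ℝ => ψ x * kernel σ θ x y) →
      bfrft σ θ ψ y = prefactor σ θ * ∫ x : ℝ, ψ x * kernel σ θ x y := by
  -- Along some sequence of radii tending to infinity the truncations converge almost everywhere;
  -- where the integral converges absolutely they also tend to the full integral.
  obtain ⟨R, hR, h⟩ :=
    ((hasBFrFT_bfrft hσ hθ hθ' ψ).tendstoInMeasure hσ hθ').exists_seq_tendsto_ae'
  filter_upwards [(volume_absolutelyContinuous_gaussMeasure hσ).ae_le h] with y hy hint
  have hcov : AECover (volume : Measure ℝ) atTop fun n => Set.Icc (-R n) (R n) :=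
    aecover_Icc (tendsto_neg_atTop_atBot.comp hR) hR
  exact tendsto_nhds_unique hy
    (((continuous_const_mul _).tendsto _).comp (hcov.integral_tendsto_of_countably_generated hint))

end

end Bicomplex

theorem mainTheorem7 (σ : ℝ) (hσ : 0 < σ) (θ : Bicomplex)
    (hθ : θ ∈ Bicomplex.unitTorus) (hθ' : IsUnit (1 - θ ^ 2)) :
    -- both transforms are defined, by their integrals, on the whole space
    (∀ ψ : Bicomplex.L2 σ, Bicomplex.HasBFrFT σ θ ψ (Bicomplex.bfrft σ θ ψ)) ∧
    (∀ ψ : Bicomplex.L2 σ,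
      Bicomplex.HasBFrFT σ θ.conjStar ψ (Bicomplex.bfrft σ θ.conjStar ψ)) ∧
    -- they are inverse to each other
    Function.LeftInverse (Bicomplex.bfrft σ θ.conjStar) (Bicomplex.bfrft σ θ) ∧
    Function.RightInverse (Bicomplex.bfrft σ θ.conjStar) (Bicomplex.bfrft σ θ) ∧
    -- where the integrals converge absolutely, the formulas hold pointwise
    (∀ ψ : Bicomplex.L2 σ, ∀ᵐ y : ℝ,
      MeasureTheory.Integrable (fun x : ℝ => ψ x * Bicomplex.kernel σ θ x y) →
      Bicomplex.bfrft σ θ ψ y =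
        Bicomplex.prefactor σ θ * ∫ x : ℝ, ψ x * Bicomplex.kernel σ θ x y) ∧
    (∀ ψ : Bicomplex.L2 σ, ∀ᵐ x : ℝ,
      MeasureTheory.Integrable (fun y : ℝ => ψ y * Bicomplex.kernel σ θ.conjStar y x) →
      Bicomplex.bfrft σ θ.conjStar ψ x =
        Bicomplex.prefactor σ θ.conjStar *
          ∫ y : ℝ, ψ y * Bicomplex.kernel σ θ.conjStar y x) := by
  have hθc := Bicomplex.conjStar_mem_unitTorus hθ
  have hθc' := Bicomplex.isUnit_one_sub_conjStar_sq hθ'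
  refine ⟨Bicomplex.hasBFrFT_bfrft hσ hθ hθ', Bicomplex.hasBFrFT_bfrft hσ hθc hθc',
    Bicomplex.bfrft_conjStar_bfrft hσ hθ hθ', fun ψ => ?_,
    Bicomplex.bfrft_ae_eq_of_integrable hσ hθ hθ', Bicomplex.bfrft_ae_eq_of_integrable hσ hθc hθc'⟩
  -- The right inverse is the left inverse for θ^*, because θ^** = θ.
  have h := Bicomplex.bfrft_conjStar_bfrft hσ hθc hθc' ψ
  rwa [Bicomplex.conjStar_conjStar] at h
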